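/- **Lemma.** Let $N\ge 1$ and let $f$ be a Maass cusp form of weight $0$ for $\Gamma_1(N)$: a smooth, $\Gamma_1(N)$-invariant, cuspidal, square-integrable function on the upper half-plane with $-y^2(\partial_x^2+\partial_y^2)f=(\tfrac14+r^2)f$ for some real $r$, of parity $\epsilon\in\{0,1\}$, i.e. $f(-\bar z)=(-1)^\epsilon f(z)$, and such that $f(z)=w\,\overline{f(-1/(Nz))}$ for some $w\in\mathbb C$ with $|w|=1$. (In particular, $f$ may be any cuspidal newform and Hecke eigenform with real spectral parameter $r$.) For $\theta\in(0,\pi/2)$ put $$\gamma_\theta(s,f)=i^{-\epsilon}w^{-1/2}\Big(\frac{\cos\theta}{\sqrt N}\Big)^{1/2-s}\Gamma_{\mathbb R}(s+\epsilon+ir)\,\Gamma_{\mathbb R}(s+\epsilon-ir)\;{}_2F_1\Big(\tfrac{s+\epsilon+ir}2,\tfrac{s+\epsilon-ir}2;\tfrac12+\epsilon;-\tan^2\theta\Big),$$ $$c_\theta(s,f)=\frac{4w^{-1/2}}{(2\pi i\tan\theta)^{\epsilon}}\,N^{\frac12(s-\frac12)},$$ where $\Gamma_{\mathbb R}(s)=\pi^{-s/2}\Gamma(s/2)$,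 $w^{-1/2}$ is the principal value, and ${}_2F_1$ is the Gauss hypergeometric function, i.e. the analytic continuation of the hypergeometric series to $\mathbb C\setminus[1,\infty)$. Let $\Gamma(a,x)=\int_x^\infty v^{a-1}e^{-v}\,dv$ for $x>0$. If $0<\sigma\le1$, $0<\theta<\delta<\frac\pi2$ and $t\in\mathbb R$, then $$|\gamma_\theta(\sigma+it,f)|<E_{\sigma,\theta,\delta}\,e^{-(\delta-\theta)|t|},$$ where $$E_{\sigma,\theta,\delta}=\frac{|c_\theta(\sigma,f)|}{(\cos(\delta-\theta))^{1/2}}\left\{\frac{\cosh(1)\,\sigma^{-1}\big(\sigma^{-1}+\log 2+e^{-1}\big)}{(2\pi)^{\sigma}\,(\cos(\delta-\theta)\cos\theta)^{\sigma-1/2}}+\frac{\Gamma\Big(\sigma-\frac12,\frac{\cos\delta}{\cos(\delta-\theta)\cos\theta}\Big)}{2\,(2\pi\cos\delta)^{\sigma-1/2}}\right\}.$$ -/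

import Mathlib

open Complex MeasureTheory Set
open scoped UpperHalfPlane MatrixGroups ContDiff ComplexConjugate

/-- Maass cusp forms `f` of weight `0` for `Γ₁(N)` with real spectral parameter `r`
(Laplace eigenvalue `1/4 + r²`), with definite parity `ε ∈ {0, 1}`, and related to the dual form by
the Fricke involution through `f(z) = w * conj (f(-1/(N z)))`, `|w| = 1`.
Every newform and Hecke eigenform with real spectral parameter is of this kind. -/
structure MaassCuspForm (N : ℕ) where
  /-- the underlying function on the upper half-plane -/
  toFun : ℍ → ℂ
  /-- the spectral parameter -/
  r : ℝ
  /-- the parity: `0` for even forms, `1` for odd forms -/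
  ε : ℕ
  /-- the constant in the Fricke relation -/
  w : ℂ
  parity_le_one : ε ≤ 1
  norm_w : ‖w‖ = 1
  smooth : ContDiffOn ℝ ∞ (fun z : ℂ => toFun (UpperHalfPlane.ofComplex z)) {z : ℂ | 0 < z.im}
  invariant : ∀ g ∈ CongruenceSubgroup.Gamma1 N, ∀ z : ℍ, toFun (g • z) = toFun z
  /-- `-y² (∂²/∂x² + ∂²/∂y²) f = (1/4 + r²) f` -/
  eigenvalue : ∀ z : ℍ,
    -((z.im : ℂ) ^ 2 *
        Laplacian.laplacian (fun u : ℂ => toFun (UpperHalfPlane.ofComplex u)) (z : ℂ))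
      = (1 / 4 + (r : ℂ) ^ 2) * toFun z
  /-- the constant term vanishes at every cusp (all cusp widths divide `N`) -/
  cuspidal : ∀ (g : SL(2, ℤ)) (z : ℍ), ∫ x in (0 : ℝ)..N, toFun (g • (x +ᵥ z)) = 0
  /-- `f` is square-integrable on `Γ₁(N) \ ℍ`: it is so on each translate of the standard
  fundamental domain of `SL(2, ℤ)`; `volume` is the hyperbolic measure `dx dy / y²` -/
  squareIntegrable : ∀ g : SL(2, ℤ),
    MemLp (fun z : ℍ => toFun (g • z)) 2 (volume.restrict ModularGroup.fd)
  parity : ∀ z : ℍ, toFun (UpperHalfPlane.ofComplex (-conj (z : ℂ))) = (-1) ^ ε * toFun z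
  fricke : ∀ z : ℍ, toFun z = w * conj (toFun (UpperHalfPlane.ofComplex (-1 / (N * (z : ℂ)))))

/-- `F` is analytic on `ℂ \ [1, ∞)` and agrees on the open unit disc with the Gauss
hypergeometric series `1 + ∑_{n ≥ 1} (a)_n (b)_n zⁿ / ((c)_n n!)`. -/
def IsGaussContinuation (a b c : ℂ) (F : ℂ → ℂ) : Prop :=
  AnalyticOnNhd ℂ F {z : ℂ | 1 - z ∈ slitPlane} ∧ ∀ z : ℂ, ‖z‖ < 1 → F z = ₂F₁ a b c z

open Classical in
/-- The Gauss hypergeometric function: the (unique) analytic continuation of the hypergeometric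
series to `ℂ \ [1, ∞)`. -/
noncomputable def gauss2F1 (a b c : ℂ) : ℂ → ℂ :=
  if h : ∃ F, IsGaussContinuation a b c F then h.choose else ₂F₁ a b c

/-- The upper incomplete gamma function `Γ(a, x) = ∫_x^∞ v^(a-1) e^(-v) dv`, for `x > 0`. -/
noncomputable def upperIncompleteGamma (a x : ℝ) : ℝ :=
  ∫ v in Ioi x, v ^ (a - 1) * Real.exp (-v)

namespace MaassCuspForm

variable {N : ℕ} (f : MaassCuspForm N)

/-- The gamma factor `γ_θ(s, f)`. -/
noncomputable def gammaFactor (θ : ℝ) (s : ℂ) : ℂ :=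
  I ^ (-(f.ε : ℤ)) * f.w ^ (-(1 / 2) : ℂ) * ((Real.cos θ / √N : ℝ) : ℂ) ^ (1 / 2 - s)
    * Gammaℝ (s + f.ε + I * f.r) * Gammaℝ (s + f.ε - I * f.r)
    * gauss2F1 ((s + f.ε + I * f.r) / 2) ((s + f.ε - I * f.r) / 2) (1 / 2 + f.ε)
        (-((Real.tan θ : ℝ) : ℂ) ^ 2)

/-- The factor `c_θ(s, f) = 4 w^(-1/2) / (2 π i tan θ)^ε * N^((s - 1/2)/2)`. -/
noncomputable def cFactor (θ : ℝ) (s : ℂ) : ℂ :=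
  4 * f.w ^ (-(1 / 2) : ℂ) / (2 * Real.pi * I * ((Real.tan θ : ℝ) : ℂ)) ^ f.ε
    * (N : ℂ) ^ (1 / 2 * (s - 1 / 2))

/-- The constant `E_{σ,θ,δ}` (attached to `f`). -/
noncomputable def decayConst (σ θ δ : ℝ) : ℝ :=
  ‖f.cFactor θ σ‖ / Real.cos (δ - θ) ^ (1 / 2 : ℝ) *
    (Real.cosh 1 * σ⁻¹ * (σ⁻¹ + Real.log 2 + Real.exp (-1))
        / ((2 * Real.pi) ^ σ * (Real.cos (δ - θ) * Real.cos θ) ^ (σ - 1 / 2))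
      + upperIncompleteGamma (σ - 1 / 2) (Real.cos δ / (Real.cos (δ - θ) * Real.cos θ))
        / (2 * (2 * Real.pi * Real.cos δ) ^ (σ - 1 / 2)))

end MaassCuspForm

/-!
Every gamma factor occurring here is governed by one integral,
`H(ζ) = ∫_ℝ e^{irv} (cosh v - ζ)^{-s} dv` (`sechTransform`), which converges and is analytic for
`ζ ∉ [1, ∞)`. Expanding in powers of `ζ` by the binomial series and evaluating the moments as Beta
integrals gives
`Γ(s) H(ζ) = ∑ₙ 2^{s+n-1} Γ((s+n+ir)/2) Γ((s+n-ir)/2) ζⁿ / n!` for `|ζ| < 1`.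
The even part (`ε = 0`) or odd part (`ε = 1`) of this series is an explicit multiple of
`ζ^ε ₂F₁(a, b; 1/2 + ε; ζ²)` with `a, b = (s + ε ± ir)/2`. Since `H(ζ)` and `H(-ζ)` are both
analytic as long as `ζ² ∉ [1, ∞)`, the parity part, divided by this multiple, is a function of
`z = ζ²` which continues the hypergeometric series to `ℂ \ [1, ∞)` (`exists_isGaussContinuation`);
the identity theorem then evaluates `gauss2F1` at `ζ = i tan θ`, that is at `z = -tan² θ` (`gauss2F1_sq`).

Exponential decay in `t = Im s` comes from rotating the ray of integration in
`Γ(s) z^{-s} = ∫₀^∞ y^{s-1} e^{-zy} dy` by an angle `β` (`norm_Gamma_mul_cpow_neg_le_of_rotation`),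
which gains `e^{-βt}` and replaces `z` by `Re (z e^{iβ})`. With `z = cosh v ∓ i tan θ`, `β = ±α` and
`α = δ - θ`, this real part is `cos α (cosh v ± T)`, where `T = tan θ tan α < 1`. What remains
is `∫₀^∞ x^{σ-1} cosh(Tx) K₀(x) dx`; it is split at `x = 1`, with
`K₀(x) ≤ log (2/x) + e^{-1}` below and `K₀(x) ≤ √(π/(2x)) e^{-x}` above
(`Gamma_mul_integral_cosh_add_rpow_le`). As `1 - T = cos δ / (cos α cos θ)`, the two pieces are the
two terms of the constant, and strictness comes from `cosh T < cosh 1`.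
-/

/-! ### Powers of the hyperbolic cosine and the Beta integral -/

theorem integrable_cosh_rpow_neg {σ : ℝ} (hσ : 0 < σ) :
    Integrable fun v : ℝ => Real.cosh v ^ (-σ) := by
  have h1 : Integrable fun v : ℝ => 2 ^ σ * Real.exp (-σ * |v|) := by
    refine Integrable.const_mul ?_ _
    rw [← integrableOn_univ, ← Iic_union_Ioi (a := (0 : ℝ))]
    refine IntegrableOn.union ?_ ?_
    · refine (integrableOn_exp_mul_Iic hσ 0).congr_fun (fun v hv => ?_) measurableSet_Iic
      simp [abs_of_nonpos (mem_Iic.1 hv)]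
    · refine (integrableOn_exp_mul_Ioi (neg_lt_zero.2 hσ) 0).congr_fun (fun v hv => ?_)
        measurableSet_Ioi
      simp [abs_of_pos (mem_Ioi.1 hv)]
  refine h1.mono' (Real.continuous_cosh.rpow_const fun v =>
    Or.inl (Real.cosh_pos v).ne').aestronglyMeasurable (Filter.Eventually.of_forall fun v => ?_)
  rw [Real.norm_of_nonneg (by positivity)]
  have h2 : Real.exp |v| / 2 ≤ Real.cosh v := by
    rw [← Real.cosh_abs, Real.cosh_eq]
    have := Real.exp_pos (-|v|)
    linarith
  calc Real.cosh v ^ (-σ) ≤ (Real.exp |v| / 2) ^ (-σ) :=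
        Real.rpow_le_rpow_of_nonpos (by positivity) h2 (by linarith)
    _ = 2 ^ σ * Real.exp (-σ * |v|) := by
        rw [Real.div_rpow (by positivity) two_pos.le, ← Real.exp_mul, Real.rpow_neg two_pos.le]
        field_simp

/-- The substitution `x = e^v / (2 cosh v)`, the logistic function of `2v`, turns the Beta integral
into an integral over the line. -/
theorem integral_exp_mul_cosh_cpow {a b : ℂ} :
    ∫ v : ℝ, cexp ((a - b) * v) * (Real.cosh v : ℂ) ^ (-(a + b))
      = 2 ^ (a + b - 1) * betaIntegral a b := by
  have himg : (fun v : ℝ => Real.sigmoid (2 * v)) '' univ = Ioo 0 1 := by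
    rw [image_univ, ← Real.range_sigmoid]
    exact (Equiv.mulLeft₀ (2 : ℝ) two_ne_zero).surjective.range_comp Real.sigmoid
  have hd : ∀ v ∈ univ, HasDerivWithinAt (fun v : ℝ => Real.sigmoid (2 * v))
      (2 * (Real.sigmoid (2 * v) * (1 - Real.sigmoid (2 * v)))) univ v := fun v _ => by
    have h : HasDerivAt (fun v : ℝ => Real.sigmoid (2 * v)) _ v :=
      (Real.hasDerivAt_sigmoid (2 * v)).comp v ((hasDerivAt_id v).const_mul 2)
    refine (h.congr_deriv ?_).hasDerivWithinAt
    ring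
  have hinj : InjOn (fun v : ℝ => Real.sigmoid (2 * v)) univ := fun x _ y _ h => by
    simpa using h
  rw [betaIntegral, intervalIntegral.integral_of_le zero_le_one, integral_Ioc_eq_integral_Ioo,
    ← himg, integral_image_eq_integral_abs_deriv_smul MeasurableSet.univ hd hinj,
    setIntegral_univ, ← integral_const_mul]
  refine integral_congr_ae (Filter.Eventually.of_forall fun v => ?_)
  have hc : 0 < Real.cosh v := Real.cosh_pos v
  have hx : Real.sigmoid (2 * v) = Real.exp v / (2 * Real.cosh v) := by
    rw [Real.sigmoid_def, Real.cosh_eq, show -(2 * v) = -v + -v by ring, Real.exp_add, Real.exp_neg]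
    field_simp
  have hy : 1 - Real.sigmoid (2 * v) = Real.exp (-v) / (2 * Real.cosh v) := by
    rw [hx, Real.cosh_eq]
    field_simp
    ring
  have hlog (u : ℝ) (c : ℂ) : ((Real.exp u / (2 * Real.cosh v) : ℝ) : ℂ) ^ (c - 1)
      = cexp ((u - Real.log 2 - Real.log (Real.cosh v)) * (c - 1)) := by
    rw [cpow_def_of_ne_zero (by exact_mod_cast (by positivity)), ← ofReal_log (by positivity),
      Real.log_div (by positivity) (by positivity), Real.log_exp,
      Real.log_mul (by positivity) (by positivity)]
    push_cast
    rw [sub_sub]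
  have hp : |2 * (Real.sigmoid (2 * v) * (1 - Real.sigmoid (2 * v)))|
      = Real.exp (-Real.log 2 - 2 * Real.log (Real.cosh v)) := by
    rw [hy, hx, abs_of_pos (by positivity), Real.exp_sub, Real.exp_neg (Real.log 2),
      Real.exp_log two_pos, two_mul (Real.log _), Real.exp_add, Real.exp_log hc, Real.exp_neg]
    field_simp
  have hy' : (1 : ℂ) - ((Real.exp v / (2 * Real.cosh v) : ℝ) : ℂ)
      = ((Real.exp (-v) / (2 * Real.cosh v) : ℝ) : ℂ) := by
    rw [← hx, ← hy]; push_cast; rfl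
  simp only
  rw [hp, hx, hy', hlog, hlog, cpow_def_of_ne_zero (by exact_mod_cast hc.ne'), ← ofReal_log hc.le,
    cpow_def_of_ne_zero two_ne_zero, real_smul, ofReal_exp, ← Complex.exp_add, ← Complex.exp_add,
    ← Complex.exp_add, ← Complex.exp_add]
  congr 1
  have : Complex.log 2 = (Real.log 2 : ℝ) := by simp
  rw [this]
  push_cast
  ring

/-! ### The transform and its Taylor expansion -/

/-- The integral `∫_ℝ e^{irv} (cosh v)^{-s} (1 - ζ / cosh v)^{-s} dv`, that is,
`∫_ℝ e^{irv} (cosh v - ζ)^{-s} dv`, written so that the principal power is applied to a quantity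
avoiding the nonpositive real axis for every `ζ ∉ [1, ∞)`. -/
noncomputable def sechTransform (s : ℂ) (r : ℝ) (ζ : ℂ) : ℂ :=
  ∫ v : ℝ, cexp (I * r * v) * (Real.cosh v : ℂ) ^ (-s) * (1 - ζ * ((Real.cosh v)⁻¹ : ℝ)) ^ (-s)

theorem inv_cosh_mem_Icc (v : ℝ) : (Real.cosh v)⁻¹ ∈ Icc (0 : ℝ) 1 :=
  ⟨inv_nonneg.2 (Real.cosh_pos v).le, inv_le_one_of_one_le₀ (Real.one_le_cosh v)⟩

theorem continuous_inv_cosh : Continuous fun v : ℝ => (Real.cosh v)⁻¹ :=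
  Real.continuous_cosh.inv₀ fun v => (Real.cosh_pos v).ne'

theorem one_sub_mul_mem_slitPlane {ζ : ℂ} (hζ : 1 - ζ ∈ slitPlane) {x : ℝ}
    (hx : x ∈ Icc (0 : ℝ) 1) :
    1 - ζ * x ∈ slitPlane := by
  have := starConvex_one_slitPlane hζ (a := 1 - x) (b := x) (by linarith [hx.2]) hx.1 (by ring)
  convert this using 1
  simp
  ring

theorem continuous_exp_mul_cosh_cpow (s : ℂ) (r : ℝ) :
    Continuous fun v : ℝ => cexp (I * r * v) * (Real.cosh v : ℂ) ^ (-s) := by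
  refine (by fun_prop : Continuous fun v : ℝ => cexp (I * r * v)).mul ?_
  exact (continuous_ofReal.comp Real.continuous_cosh).cpow continuous_const
    fun v => Or.inl (by simpa using Real.cosh_pos v)

theorem norm_exp_mul_cosh_cpow (s : ℂ) (r v : ℝ) :
    ‖cexp (I * r * v) * (Real.cosh v : ℂ) ^ (-s)‖ = Real.cosh v ^ (-s.re) := by
  rw [norm_mul, norm_cpow_eq_rpow_re_of_pos (Real.cosh_pos v), norm_exp]
  simp

theorem integrable_exp_mul_cosh_cpow {s : ℂ} (hs : 0 < s.re) (r : ℝ) :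
    Integrable fun v : ℝ => cexp (I * r * v) * (Real.cosh v : ℂ) ^ (-s) :=
  (integrable_cosh_rpow_neg hs).mono' (continuous_exp_mul_cosh_cpow s r).aestronglyMeasurable
    (Filter.Eventually.of_forall fun v => (norm_exp_mul_cosh_cpow s r v).le)

theorem integrable_sechTransform {s : ℂ} (hs : 0 < s.re) (r : ℝ) {ζ : ℂ} (hζ : 1 - ζ ∈ slitPlane)
    (c : ℂ) :
    Integrable fun v : ℝ => cexp (I * r * v) * (Real.cosh v : ℂ) ^ (-s) *
      (1 - ζ * ((Real.cosh v)⁻¹ : ℝ)) ^ c := by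
  have hc : ContinuousOn (fun x : ℝ => (1 - ζ * x) ^ c) (Icc 0 1) := fun x hx =>
    ((by fun_prop : ContinuousAt (fun x : ℝ => 1 - ζ * x) x).cpow continuousAt_const
      (one_sub_mul_mem_slitPlane hζ hx)).continuousWithinAt
  obtain ⟨C, hC⟩ := isCompact_Icc.exists_bound_of_continuousOn hc
  refine (integrable_exp_mul_cosh_cpow hs r).mul_bdd (c := C) ?_
    (Filter.Eventually.of_forall fun v => hC _ (inv_cosh_mem_Icc v))
  exact (hc.comp_continuous continuous_inv_cosh inv_cosh_mem_Icc).aestronglyMeasurable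

theorem analyticOnNhd_sechTransform {s : ℂ} (hs : 0 < s.re) (r : ℝ) :
    AnalyticOnNhd ℂ (sechTransform s r) {ζ : ℂ | 1 - ζ ∈ slitPlane} := by
  have hopen : IsOpen {ζ : ℂ | 1 - ζ ∈ slitPlane} :=
    isOpen_slitPlane.preimage (by fun_prop : Continuous fun ζ : ℂ => 1 - ζ)
  refine DifferentiableOn.analyticOnNhd (fun ζ₀ hζ₀ => ?_) hopen
  obtain ⟨δ, hδ, hball⟩ := Metric.nhds_basis_closedBall.mem_iff.1 (hopen.mem_nhds hζ₀)
  have hc : ContinuousOn (fun p : ℂ × ℝ => (1 - p.1 * p.2) ^ (-s - 1))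
      (Metric.closedBall ζ₀ δ ×ˢ Icc 0 1) := fun p hp =>
    ((by fun_prop : ContinuousAt (fun p : ℂ × ℝ => 1 - p.1 * p.2) p).cpow continuousAt_const
      (one_sub_mul_mem_slitPlane (hball hp.1) hp.2)).continuousWithinAt
  obtain ⟨C, hC⟩ :=
    ((isCompact_closedBall ζ₀ δ).prod isCompact_Icc).exists_bound_of_continuousOn hc
  refine (hasDerivAt_integral_of_dominated_loc_of_deriv_le (μ := volume)
    (Metric.closedBall_mem_nhds ζ₀ hδ)
    (F := fun (ζ : ℂ) (v : ℝ) => cexp (I * r * v) * (Real.cosh v : ℂ) ^ (-s) *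
      (1 - ζ * ((Real.cosh v)⁻¹ : ℝ)) ^ (-s))
    (F' := fun (ζ : ℂ) (v : ℝ) => cexp (I * r * v) * (Real.cosh v : ℂ) ^ (-s) *
      (-s * (1 - ζ * ((Real.cosh v)⁻¹ : ℝ)) ^ (-s - 1) * -((Real.cosh v)⁻¹ : ℝ)))
    (bound := fun v => Real.cosh v ^ (-s.re) * (‖s‖ * C))
    ?_ (integrable_sechTransform hs r hζ₀ _) ?_ ?_
    ((integrable_cosh_rpow_neg hs).mul_const _) ?_).2.differentiableAt.differentiableWithinAt
  · filter_upwards [hopen.mem_nhds hζ₀] with ζ hζ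
    exact (integrable_sechTransform hs r hζ _).aestronglyMeasurable
  · have h := (integrable_sechTransform hs r hζ₀ (-s - 1)).aestronglyMeasurable
    refine ((h.const_mul (-s)).mul
      (continuous_ofReal.comp continuous_inv_cosh).neg.aestronglyMeasurable).congr ?_
    refine Filter.Eventually.of_forall fun v => ?_
    simp
    ring
  · refine Filter.Eventually.of_forall fun v ζ hζ => ?_
    rw [norm_mul, norm_exp_mul_cosh_cpow, norm_mul, norm_mul, norm_neg, norm_neg, norm_real,
      Real.norm_of_nonneg (inv_cosh_mem_Icc v).1]
    have h1 := hC (ζ, (Real.cosh v)⁻¹) ⟨hζ, inv_cosh_mem_Icc v⟩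
    have h3 := inv_cosh_mem_Icc v
    refine mul_le_mul_of_nonneg_left ?_ (Real.rpow_nonneg (Real.cosh_pos v).le _)
    exact (mul_le_of_le_one_right (by positivity) h3.2).trans
      (mul_le_mul_of_nonneg_left h1 (norm_nonneg _))
  · refine Filter.Eventually.of_forall fun v ζ hζ => HasDerivAt.const_mul _ ?_
    refine HasDerivAt.cpow_const ?_ (one_sub_mul_mem_slitPlane (hball hζ) (inv_cosh_mem_Icc v))
    exact (hasDerivAt_mul_const _).const_sub 1

theorem hasSum_one_sub_cpow_neg (s : ℂ) {z : ℂ} (hz : ‖z‖ < 1) :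
    HasSum (fun n : ℕ => (ascPochhammer ℂ n).eval s / n.factorial * z ^ n) ((1 - z) ^ (-s)) := by
  have h := (one_div_one_sub_cpow_hasFPowerSeriesOnBall_zero s).hasSum (y := z)
    (by simpa [← ofReal_norm] using hz)
  simp only [FormalMultilinearSeries.ofScalars_apply_eq, zero_add, smul_eq_mul, one_div,
    ← cpow_neg] at h
  convert! h using 3 with n
  rw [← Ring.multichoose_eq, div_eq_iff (by exact_mod_cast n.factorial_ne_zero), mul_comm,
    ← nsmul_eq_mul, Ring.factorial_nsmul_multichoose_eq_ascPochhammer]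
  rw [← Polynomial.ascPochhammer_smeval_eq_eval]

theorem Gamma_mul_integral_exp_mul_cosh_cpow_mul_pow {s : ℂ} (hs : 0 < s.re) (r : ℝ) (n : ℕ) :
    Gamma (s + n) * ∫ v : ℝ, cexp (I * r * v) * (Real.cosh v : ℂ) ^ (-s) *
        (((Real.cosh v)⁻¹ : ℝ) : ℂ) ^ n
      = 2 ^ (s + n - 1) * (Gamma ((s + n + I * r) / 2) * Gamma ((s + n - I * r) / 2)) := by
  have hn : (0 : ℝ) ≤ n := n.cast_nonneg
  rw [Gamma_mul_Gamma_eq_betaIntegral (by simp; linarith) (by simp; linarith),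
    show (s + n + I * r) / 2 + (s + n - I * r) / 2 = s + n by ring, mul_left_comm]
  have h := integral_exp_mul_cosh_cpow (a := (s + n + I * r) / 2) (b := (s + n - I * r) / 2)
  rw [show (s + n + I * r) / 2 + (s + n - I * r) / 2 = s + n by ring,
    show (s + n + I * r) / 2 - (s + n - I * r) / 2 = I * r by ring] at h
  rw [← h]
  congr 1
  refine integral_congr_ae (Filter.Eventually.of_forall fun v => ?_)
  have hc : (Real.cosh v : ℂ) ≠ 0 := by exact_mod_cast (Real.cosh_pos v).ne'
  simp only
  rw [neg_add, cpow_add _ _ hc, cpow_neg _ (n : ℂ), cpow_natCast, ofReal_inv, inv_pow, mul_assoc]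

/-- The Taylor expansion of `Γ(s)` times the transform, obtained by integrating the binomial series
termwise and evaluating the moments of `e^{irv} (cosh v)^{-s}` as Beta integrals. -/
theorem hasSum_Gamma_mul_sechTransform {s : ℂ} (hs : 0 < s.re) (r : ℝ) {ζ : ℂ} (hζ : ‖ζ‖ < 1) :
    HasSum (fun n : ℕ => ζ ^ n / n.factorial * (2 ^ (s + n - 1) *
        (Gamma ((s + n + I * r) / 2) * Gamma ((s + n - I * r) / 2))))
      (Gamma s * sechTransform s r ζ) := by
  set φ : ℝ → ℂ := fun v => cexp (I * r * v) * (Real.cosh v : ℂ) ^ (-s) with hφ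
  set F : ℕ → ℝ → ℂ := fun n v => φ v *
    ((ascPochhammer ℂ n).eval s / n.factorial * (ζ * ((Real.cosh v)⁻¹ : ℝ)) ^ n) with hF
  have hbd (n : ℕ) (v : ℝ) : ‖F n v‖ ≤
      Real.cosh v ^ (-s.re) * ‖(ascPochhammer ℂ n).eval s / n.factorial * ζ ^ n‖ := by
    rw [hF]
    simp only
    rw [norm_mul, norm_exp_mul_cosh_cpow, mul_pow, ← mul_assoc, norm_mul _ (_ ^ n), norm_pow,
      norm_real, Real.norm_of_nonneg (inv_cosh_mem_Icc v).1]
    have := (inv_cosh_mem_Icc v)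
    have h1 : (Real.cosh v)⁻¹ ^ n ≤ 1 := pow_le_one₀ this.1 this.2
    have h2 := (Real.cosh_pos v).le
    gcongr
    exact mul_le_of_le_one_right (norm_nonneg _) h1
  have hint (n : ℕ) : Integrable (F n) := by
    refine ((integrable_cosh_rpow_neg hs).mul_const _).mono' ?_
      (Filter.Eventually.of_forall (hbd n))
    exact ((continuous_exp_mul_cosh_cpow s r).mul (continuous_const.mul ((continuous_const.mul
      (continuous_ofReal.comp continuous_inv_cosh)).pow n))).aestronglyMeasurable
  have hsum : Summable fun n => ∫ v, ‖F n v‖ := by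
    refine Summable.of_nonneg_of_le (fun n => integral_nonneg fun v => norm_nonneg _)
      (fun n => integral_mono (hint n).norm ((integrable_cosh_rpow_neg hs).mul_const _) (hbd n)) ?_
    simp only [integral_mul_const]
    exact ((hasSum_one_sub_cpow_neg s hζ).summable.norm).mul_left _
  have key := (hasSum_integral_of_summable_integral_norm hint hsum).mul_left (Gamma s)
  convert! key using 1
  · funext n
    have hG : Gamma s * (ascPochhammer ℂ n).eval s = Gamma (s + n) := by
      have hk (k : ℕ) : s ≠ -k := fun h => by
        have := congrArg re h
        simp at this
        have : (0 : ℝ) ≤ k := k.cast_nonneg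
        linarith
      rw [← Gamma_add_nat_div_Gamma_eq s hk, mul_div_cancel₀ _ (Gamma_ne_zero_of_re_pos hs)]
    have hF' : ∫ v, F n v = (ascPochhammer ℂ n).eval s / n.factorial * ζ ^ n *
        ∫ v : ℝ, φ v * (((Real.cosh v)⁻¹ : ℝ) : ℂ) ^ n := by
      rw [← integral_const_mul]
      refine integral_congr_ae (Filter.Eventually.of_forall fun v => ?_)
      simp only [hF, mul_pow]
      ring
    rw [hF', ← Gamma_mul_integral_exp_mul_cosh_cpow_mul_pow hs, ← hG]
    ring
  · congr 1
    refine integral_congr_ae (Filter.Eventually.of_forall fun v => ?_)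
    have hlt : ‖ζ * ((Real.cosh v)⁻¹ : ℝ)‖ < 1 := by
      rw [norm_mul, norm_real, Real.norm_of_nonneg (inv_cosh_mem_Icc v).1]
      exact (mul_le_of_le_one_right (norm_nonneg _) (inv_cosh_mem_Icc v).2).trans_lt hζ
    simp only [hF]
    rw [tsum_mul_left, (hasSum_one_sub_cpow_neg s hlt).tsum_eq]

/-! ### Analytic continuation of the Gauss hypergeometric series -/

/-- The part of `Γ(s)` times the transform which is even in `ζ` for `ε = 0` and odd for `ε = 1`. -/
noncomputable def parityTransform (s : ℂ) (r : ℝ) (ε : ℕ) (ζ : ℂ) : ℂ :=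
  Gamma s * (sechTransform s r ζ + (-1) ^ ε * sechTransform s r (-ζ)) / 2

theorem parityTransform_neg (s : ℂ) (r : ℝ) (ε : ℕ) (ζ : ℂ) :
    parityTransform s r ε (-ζ) = (-1) ^ ε * parityTransform s r ε ζ := by
  have h : ((-1 : ℂ) ^ ε) * (-1) ^ ε = 1 := by rw [← mul_pow]; simp
  simp only [parityTransform, neg_neg]
  linear_combination (-Gamma s * sechTransform s r (-ζ) / 2) * h

theorem factorial_two_mul_add_eq {ε : ℕ} (hε : ε ≤ 1) (k : ℕ) :
    ((2 * k + ε).factorial : ℂ)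
      = 4 ^ k * k.factorial * (ascPochhammer ℂ k).eval (1 / 2 + (ε : ℂ)) := by
  induction k with
  | zero => interval_cases ε <;> simp
  | succ k ih =>
    rw [show 2 * (k + 1) + ε = 2 * k + ε + 1 + 1 by ring, Nat.factorial_succ, Nat.factorial_succ,
      Nat.cast_mul, Nat.cast_mul, ih, ascPochhammer_succ_eval, Nat.factorial_succ]
    interval_cases ε <;> push_cast <;> ring

theorem parityTransform_eq_ordinaryHypergeometric {s : ℂ} (hs : 0 < s.re) (r : ℝ) {ε : ℕ}
    (hε : ε ≤ 1) {ζ : ℂ} (hζ : ‖ζ‖ < 1) :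
    parityTransform s r ε ζ = 2 ^ (s + ε - 1) * ζ ^ ε *
      (Gamma ((s + ε + I * r) / 2) * Gamma ((s + ε - I * r) / 2)) *
        ₂F₁ ((s + ε + I * r) / 2) ((s + ε - I * r) / 2) (1 / 2 + (ε : ℂ)) (ζ ^ 2) := by
  set f : ℕ → ℂ := fun n => ζ ^ n / n.factorial * (2 ^ (s + n - 1) *
        (Gamma ((s + n + I * r) / 2) * Gamma ((s + n - I * r) / 2))) with hf
  have h1 : HasSum f (Gamma s * sechTransform s r ζ) := hasSum_Gamma_mul_sechTransform hs r hζ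
  have h2 : HasSum (fun n => (-1) ^ n * f n) (Gamma s * sechTransform s r (-ζ)) := by
    convert! hasSum_Gamma_mul_sechTransform hs r (ζ := -ζ) (by simpa using hζ) using 2 with n
    rw [hf, neg_pow ζ]
    ring
  have h3 : HasSum (fun n => (f n + (-1) ^ ε * ((-1) ^ n * f n)) / 2)
      (parityTransform s r ε ζ) := by
    convert! (h1.add (h2.mul_left ((-1) ^ ε))).div_const 2 using 1
    rw [parityTransform]
    ring
  -- only the indices `n = 2k + ε` survive
  have hinj : Function.Injective fun k : ℕ => 2 * k + ε := fun a b h => by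
    simpa using h
  rw [← hinj.hasSum_iff] at h3
  · rw [ordinaryHypergeometric_eq_tsum, ← h3.tsum_eq, ← tsum_mul_left]
    refine tsum_congr fun k => ?_
    have hεn : (0 : ℝ) ≤ ε := ε.cast_nonneg
    have hpoch (a : ℂ) (ha : 0 < a.re) :
        Gamma (a + k) = Gamma a * (ascPochhammer ℂ k).eval a := by
      have hk (j : ℕ) : a ≠ -j := fun h => by
        have := congrArg re h
        have hj : (0 : ℝ) ≤ j := j.cast_nonneg
        simp at this
        linarith
      rw [← Gamma_add_nat_div_Gamma_eq a hk, mul_div_cancel₀ _ (Gamma_ne_zero_of_re_pos ha)]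
    have ha := hpoch ((s + ε + I * r) / 2) (by simp; linarith)
    have hb := hpoch ((s + ε - I * r) / 2) (by simp; linarith)
    have hsign : ((-1 : ℂ) ^ ε) * (-1) ^ (2 * k + ε) = 1 := by
      rw [← pow_add, show ε + (2 * k + ε) = 2 * (k + ε) by ring, pow_mul]
      simp
    have hpow : (2 : ℂ) ^ (s + (2 * k + ε : ℕ) - 1) = 2 ^ (s + ε - 1) * 4 ^ k := by
      rw [show s + ((2 * k + ε : ℕ) : ℂ) - 1 = (s + ε - 1) + ((2 * k : ℕ) : ℂ) by push_cast; ring,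
        cpow_add _ _ two_ne_zero, cpow_natCast, pow_mul]
      norm_num
    have hfac : (k.factorial : ℂ) ≠ 0 := by exact_mod_cast k.factorial_ne_zero
    have hfac2 := factorial_two_mul_add_eq hε k
    have hne : (4 : ℂ) ^ k * k.factorial * (ascPochhammer ℂ k).eval (1 / 2 + (ε : ℂ)) ≠ 0 := by
      rw [← hfac2]
      exact_mod_cast Nat.factorial_ne_zero _
    have hasc := right_ne_zero_of_mul hne
    simp only [Function.comp_apply]
    rw [← mul_assoc ((-1 : ℂ) ^ ε), hsign, one_mul, hf]
    simp only
    rw [hfac2, hpow,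
      show (s + ((2 * k + ε : ℕ) : ℂ) + I * r) / 2 = (s + ε + I * r) / 2 + k by push_cast; ring,
      show (s + ((2 * k + ε : ℕ) : ℂ) - I * r) / 2 = (s + ε - I * r) / 2 + k by push_cast; ring,
      ha, hb, smul_eq_mul, pow_add, pow_mul]
    field_simp
    ring
  · intro n hn
    have hodd : Odd (ε + n) := by
      by_contra h
      rw [Nat.not_odd_iff_even] at h
      refine hn ⟨(n - ε) / 2, ?_⟩
      simp only
      rcases h with ⟨m, hm⟩
      interval_cases ε <;> omega
    rw [← mul_assoc, ← pow_add, hodd.neg_one_pow]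
    simp

theorem one_sub_mem_slitPlane_of_one_sub_sq {ζ : ℂ} (h : 1 - ζ ^ 2 ∈ slitPlane) :
    1 - ζ ∈ slitPlane := by
  by_contra hc
  rw [mem_slitPlane_iff, not_or, not_lt, not_not] at hc
  obtain ⟨hre, him⟩ := hc
  simp at hre him
  rw [mem_slitPlane_iff] at h
  simp [pow_two, him] at h
  nlinarith

theorem analyticAt_parityTransform {s : ℂ} (hs : 0 < s.re) (r : ℝ) (ε : ℕ) {ζ : ℂ}
    (hζ : 1 - ζ ^ 2 ∈ slitPlane) : AnalyticAt ℂ (parityTransform s r ε) ζ := by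
  have h1 : AnalyticAt ℂ (sechTransform s r) ζ :=
    analyticOnNhd_sechTransform hs r ζ (one_sub_mem_slitPlane_of_one_sub_sq hζ)
  have h2 : AnalyticAt ℂ (sechTransform s r) (-ζ) :=
    analyticOnNhd_sechTransform hs r (-ζ) (one_sub_mem_slitPlane_of_one_sub_sq (by simpa using hζ))
  have h3 : AnalyticAt ℂ (fun ζ => sechTransform s r (-ζ)) ζ := h2.fun_comp analyticAt_id.neg
  exact (analyticAt_const.mul (h1.add (analyticAt_const.mul h3))).div_const

theorem exists_analyticAt_sq_eq {z : ℂ} (hz : z ≠ 0) :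
    ∃ g : ℂ → ℂ, AnalyticAt ℂ g z ∧ ∀ w, g w ^ 2 = w := by
  have hsq (w : ℂ) : (w ^ (1 / 2 : ℂ)) ^ 2 = w := by
    rw [← cpow_nat_mul]
    simp
  rcases mem_slitPlane_or_neg_mem_slitPlane hz with h | h
  · exact ⟨fun w => w ^ (1 / 2 : ℂ), analyticAt_id.cpow analyticAt_const h, hsq⟩
  · refine ⟨fun w => I * (-w) ^ (1 / 2 : ℂ),
      analyticAt_const.mul (analyticAt_id.neg.cpow analyticAt_const h), fun w => ?_⟩
    rw [mul_pow, hsq]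
    simp

theorem IsGaussContinuation.eqOn {a b c : ℂ} {F G : ℂ → ℂ} (hF : IsGaussContinuation a b c F)
    (hG : IsGaussContinuation a b c G) : EqOn F G {z : ℂ | 1 - z ∈ slitPlane} := by
  have himg : {z : ℂ | 1 - z ∈ slitPlane} = (fun z => 1 - z) '' slitPlane := by
    ext z
    exact ⟨fun h => ⟨1 - z, h, by simp⟩, by rintro ⟨w, hw, rfl⟩; simpa using hw⟩
  have hconn : IsPreconnected {z : ℂ | 1 - z ∈ slitPlane} := by
    rw [himg]
    exact (starConvex_one_slitPlane.isPathConnected one_mem_slitPlane)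
      |>.isConnected.isPreconnected.image _ (by fun_prop)
  refine hF.1.eqOn_of_preconnected_of_eventuallyEq hG.1 hconn (z₀ := 0) (by simp) ?_
  filter_upwards [Metric.ball_mem_nhds (0 : ℂ) one_pos] with z hz
  have hz : ‖z‖ < 1 := by simpa using hz
  rw [hF.2 z hz, hG.2 z hz]

/-- The normalized parity transform is even in `ζ`, hence a function of `z = ζ²` away from `z = 0`;
any local branch of `√z` shows that it is analytic there, and near `z = 0` it is the hypergeometric
series. -/
theorem exists_isGaussContinuation {s : ℂ} (hs : 0 < s.re) (r : ℝ) {ε : ℕ} (hε : ε ≤ 1) :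
    ∃ F, IsGaussContinuation ((s + ε + I * r) / 2) ((s + ε - I * r) / 2) (1 / 2 + (ε : ℂ)) F ∧
      ∀ ζ ≠ 0, F (ζ ^ 2) = parityTransform s r ε ζ / (2 ^ (s + ε - 1) * ζ ^ ε *
        (Gamma ((s + ε + I * r) / 2) * Gamma ((s + ε - I * r) / 2))) := by
  have hεn : (0 : ℝ) ≤ ε := ε.cast_nonneg
  set a := (s + ε + I * r) / 2 with ha
  set b := (s + ε - I * r) / 2 with hb
  set c : ℂ := 1 / 2 + (ε : ℂ) with hc
  have hare : 0 < a.re := by simp [ha]; linarith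
  have hbre : 0 < b.re := by simp [hb]; linarith
  have hcre : 0 < c.re := by simp [hc]; linarith
  have hne : Gamma a * Gamma b ≠ 0 :=
    mul_ne_zero (Gamma_ne_zero_of_re_pos hare) (Gamma_ne_zero_of_re_pos hbre)
  have h2ne : (2 : ℂ) ^ (s + ε - 1) ≠ 0 := by simp [cpow_eq_zero_iff]
  set Q : ℂ → ℂ := fun ζ =>
    parityTransform s r ε ζ / (2 ^ (s + ε - 1) * ζ ^ ε * (Gamma a * Gamma b)) with hQ
  have hQneg (ζ : ℂ) : Q (-ζ) = Q ζ := by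
    have h : ((-1 : ℂ) ^ ε) ≠ 0 := pow_ne_zero _ (by simp)
    simp only [hQ]
    rw [parityTransform_neg, neg_pow ζ,
      show (2 : ℂ) ^ (s + ε - 1) * ((-1) ^ ε * ζ ^ ε) * (Gamma a * Gamma b)
        = (-1) ^ ε * (2 ^ (s + ε - 1) * ζ ^ ε * (Gamma a * Gamma b)) by ring,
      mul_div_mul_left _ _ h]
  have hQsq {ζ ξ : ℂ} (h : ζ ^ 2 = ξ ^ 2) : Q ζ = Q ξ := by
    rcases sq_eq_sq_iff_eq_or_eq_neg.1 h with rfl | rfl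
    · rfl
    · exact hQneg ξ
  have hsqrt (w : ℂ) : (w ^ (1 / 2 : ℂ)) ^ 2 = w := by
    rw [← cpow_nat_mul]
    simp
  -- the value at `0` is set by hand, since `Q 0` is `0 / 0` for `ε = 1`
  set F : ℂ → ℂ := fun z => if z = 0 then 1 else Q (z ^ (1 / 2 : ℂ)) with hF
  have hFQ (ζ : ℂ) (hζ : ζ ≠ 0) : F (ζ ^ 2) = Q ζ := by
    simp only [hF, if_neg (pow_ne_zero 2 hζ)]
    exact hQsq (hsqrt _)
  have hFdisc (z : ℂ) (hz : ‖z‖ < 1) : F z = ₂F₁ a b c z := by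
    by_cases hz0 : z = 0
    · simp [hF, hz0]
    · obtain ⟨ζ, rfl⟩ : ∃ ζ, ζ ^ 2 = z := ⟨_, hsqrt z⟩
      have hζ0 : ζ ≠ 0 := fun h => hz0 (by simp [h])
      have hζ : ‖ζ‖ < 1 := by
        rw [norm_pow] at hz
        exact (pow_lt_one_iff_of_nonneg (norm_nonneg _) two_ne_zero).1 hz
      rw [hFQ ζ hζ0]
      simp only [hQ]
      rw [parityTransform_eq_ordinaryHypergeometric hs r hε hζ, mul_div_cancel_left₀]
      exact mul_ne_zero (mul_ne_zero h2ne (pow_ne_zero _ hζ0)) hne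
  refine ⟨F, ⟨fun z hz => ?_, hFdisc⟩, hFQ⟩
  by_cases hz0 : z = 0
  · subst hz0
    have hneg {x : ℂ} (hx : 0 < x.re) (k : ℕ) : (k : ℂ) ≠ -x := fun h => by
      have := congrArg re h
      have hk : (0 : ℝ) ≤ k := k.cast_nonneg
      simp at this
      linarith
    have hrad : (ordinaryHypergeometricSeries ℂ a b c).radius = 1 :=
      ordinaryHypergeometricSeries_radius_eq_one ℂ a b c
        fun k => ⟨hneg hare k, hneg hbre k, hneg hcre k⟩
    have han : AnalyticAt ℂ (₂F₁ a b c : ℂ → ℂ) 0 :=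
      ((ordinaryHypergeometricSeries ℂ a b c).hasFPowerSeriesOnBall (by simp [hrad])).analyticAt
    refine han.congr ?_
    filter_upwards [Metric.ball_mem_nhds (0 : ℂ) one_pos] with w hw
    exact (hFdisc w (by simpa using hw)).symm
  · obtain ⟨g, hg, hgsq⟩ := exists_analyticAt_sq_eq hz0
    have hg0 : g z ≠ 0 := fun h => hz0 (by rw [← hgsq z, h]; simp)
    have hQan : AnalyticAt ℂ Q (g z) := by
      refine (analyticAt_parityTransform hs r ε (by rw [hgsq]; exact hz)).div
        ((analyticAt_const.mul (analyticAt_id.pow ε)).mul analyticAt_const) ?_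
      exact mul_ne_zero (mul_ne_zero h2ne (pow_ne_zero _ hg0)) hne
    refine (hQan.comp hg).congr ?_
    filter_upwards [isOpen_ne.mem_nhds hz0] with w hw
    have hw0 : g w ≠ 0 := fun h => hw (by rw [← hgsq w, h]; simp)
    rw [Function.comp_apply, ← hFQ _ hw0, hgsq]

/-- The integral representation of the continued Gauss function, valid in particular at
`ζ = i tan θ`, where `ζ²` may lie outside the disc of convergence. -/
theorem gauss2F1_sq {s : ℂ} (hs : 0 < s.re) (r : ℝ) {ε : ℕ} (hε : ε ≤ 1) {ζ : ℂ} (hζ0 : ζ ≠ 0)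
    (hζ : 1 - ζ ^ 2 ∈ slitPlane) :
    2 ^ (s + ε - 1) * ζ ^ ε * (Gamma ((s + ε + I * r) / 2) * Gamma ((s + ε - I * r) / 2)) *
        gauss2F1 ((s + ε + I * r) / 2) ((s + ε - I * r) / 2) (1 / 2 + (ε : ℂ)) (ζ ^ 2)
      = parityTransform s r ε ζ := by
  have hεn : (0 : ℝ) ≤ ε := ε.cast_nonneg
  obtain ⟨F, hF, hFval⟩ := exists_isGaussContinuation hs r hε
  have hex : ∃ F, IsGaussContinuation ((s + ε + I * r) / 2) ((s + ε - I * r) / 2)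
    (1 / 2 + (ε : ℂ)) F := ⟨F, hF⟩
  have heq : gauss2F1 ((s + ε + I * r) / 2) ((s + ε - I * r) / 2) (1 / 2 + (ε : ℂ)) (ζ ^ 2)
      = F (ζ ^ 2) := by
    rw [gauss2F1, dif_pos hex]
    exact hex.choose_spec.eqOn hF hζ
  rw [heq, hFval ζ hζ0, mul_div_cancel₀]
  refine mul_ne_zero (mul_ne_zero (by simp [cpow_eq_zero_iff]) (pow_ne_zero _ hζ0))
    (mul_ne_zero ?_ ?_)
  · exact Gamma_ne_zero_of_re_pos (by simp; linarith)
  · exact Gamma_ne_zero_of_re_pos (by simp; linarith)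

/-! ### The Gamma integral along a rotated ray -/

theorem integrableOn_cpow_mul_exp_neg_mul {s z : ℂ} (hs : 0 < s.re) (hz : 0 < z.re) :
    IntegrableOn (fun y : ℝ => (y : ℂ) ^ (s - 1) * cexp (-(z * y))) (Ioi 0) := by
  have h1 : IntegrableOn (fun y : ℝ => y ^ (s.re - 1) * Real.exp (-z.re * y)) (Ioi 0) := by
    simpa using integrableOn_rpow_mul_exp_neg_mul_rpow (p := 1) (s := s.re - 1) (b := z.re)
      (by linarith) one_pos hz
  refine Integrable.mono' h1 ?_ ?_
  · refine ContinuousOn.aestronglyMeasurable (fun y hy => ?_) measurableSet_Ioi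
    exact ((continuousAt_ofReal_cpow_const _ _ (Or.inr (ne_of_gt hy))).mul
      (by fun_prop)).continuousWithinAt
  · refine (ae_restrict_iff' measurableSet_Ioi).2 (Filter.Eventually.of_forall fun y hy => ?_)
    rw [norm_mul, norm_cpow_eq_rpow_re_of_pos hy, norm_exp]
    simp

/-- Both sides are analytic on the right half-plane and agree for `z > 0`. -/
theorem Gamma_mul_cpow_neg_eq_integral {s z : ℂ} (hs : 0 < s.re) (hz : 0 < z.re) :
    Gamma s * z ^ (-s) = ∫ y : ℝ in Ioi 0, (y : ℂ) ^ (s - 1) * cexp (-(z * y)) := by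
  have hopen : IsOpen {z : ℂ | 0 < z.re} := isOpen_lt continuous_const continuous_re
  have hconv : Convex ℝ {z : ℂ | 0 < z.re} := convex_halfSpace_re_gt 0
  have hA : AnalyticOnNhd ℂ (fun z : ℂ => Gamma s * z ^ (-s)) {z : ℂ | 0 < z.re} := by
    refine DifferentiableOn.analyticOnNhd (fun w hw => ?_) hopen
    exact ((differentiableAt_id.cpow_const (Or.inl hw)).const_mul _).differentiableWithinAt
  have hB : AnalyticOnNhd ℂ
      (fun z : ℂ => ∫ y : ℝ in Ioi 0, (y : ℂ) ^ (s - 1) * cexp (-(z * y)))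
      {z : ℂ | 0 < z.re} := by
    refine DifferentiableOn.analyticOnNhd (fun w hw => ?_) hopen
    have hw : 0 < w.re := hw
    have hball : {z : ℂ | w.re / 2 < z.re} ∈ nhds w :=
      (isOpen_lt continuous_const continuous_re).mem_nhds (by simpa using hw)
    have hbd : IntegrableOn (fun y : ℝ => y ^ s.re * Real.exp (-(w.re / 2) * y)) (Ioi 0) := by
      simpa using integrableOn_rpow_mul_exp_neg_mul_rpow (p := 1) (s := s.re) (b := w.re / 2)
        (by linarith) one_pos (by linarith)
    refine (hasDerivAt_integral_of_dominated_loc_of_deriv_le (μ := volume.restrict (Ioi 0)) hball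
      (F := fun (z : ℂ) (y : ℝ) => (y : ℂ) ^ (s - 1) * cexp (-(z * y)))
      (bound := fun y : ℝ => y ^ s.re * Real.exp (-(w.re / 2) * y))
      (F' := fun z y => (y : ℂ) ^ (s - 1) * (cexp (-(z * y)) * (-(y : ℂ))))
      ?_ (integrableOn_cpow_mul_exp_neg_mul hs hw) ?_ ?_ hbd
      ?_).2.differentiableAt.differentiableWithinAt
    · filter_upwards [hopen.mem_nhds hw] with u hu
      exact (integrableOn_cpow_mul_exp_neg_mul hs hu).aestronglyMeasurable
    · simp only [← mul_assoc]
      exact (integrableOn_cpow_mul_exp_neg_mul hs hw).aestronglyMeasurable.mul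
        (by fun_prop)
    · refine (ae_restrict_iff' measurableSet_Ioi).2
        (Filter.Eventually.of_forall fun y hy u hu => ?_)
      have hy : 0 < y := hy
      have hu : w.re / 2 < u.re := hu
      rw [norm_mul, norm_mul, norm_neg, norm_cpow_eq_rpow_re_of_pos hy, norm_exp, norm_real,
        Real.norm_of_nonneg hy.le, mul_comm (Real.exp _), ← mul_assoc, sub_re, one_re,
        Real.rpow_sub_one hy.ne', div_mul_cancel₀ _ hy.ne']
      gcongr
      simp
      nlinarith
    · refine Filter.Eventually.of_forall fun y u _ => ?_
      refine (HasDerivAt.cexp ?_).const_mul _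
      exact ((hasDerivAt_mul_const (y : ℂ)).fun_neg)
  refine hA.eqOn_of_preconnected_of_frequently_eq hB hconv.isPreconnected
    (z₀ := 1) (by simp) ?_ hz
  have hreal : ∀ x : ℝ, 0 < x → Gamma s * (x : ℂ) ^ (-s)
      = ∫ y : ℝ in Ioi 0, (y : ℂ) ^ (s - 1) * cexp (-((x : ℂ) * y)) := fun x hx => by
    rw [integral_cpow_mul_exp_neg_mul_Ioi hs hx, one_div, ← ofReal_inv,
      ofReal_inv, inv_cpow, ← cpow_neg, mul_comm]
    rw [arg_ofReal_of_nonneg hx.le]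
    exact Real.pi_pos.ne
  have ht : Filter.Tendsto (fun x : ℝ => (x : ℂ)) (nhdsWithin 1 {1}ᶜ) (nhdsWithin 1 {1}ᶜ) := by
    refine tendsto_nhdsWithin_of_tendsto_nhds_of_eventually_within _ ?_ ?_
    · simpa using (continuous_ofReal.tendsto (1 : ℝ)).mono_left nhdsWithin_le_nhds
    · filter_upwards [self_mem_nhdsWithin] with x hx
      simpa using hx
  refine ht.frequently (Filter.Eventually.frequently ?_)
  filter_upwards [nhdsWithin_le_nhds (Ioi_mem_nhds (zero_lt_one (α := ℝ)))] with x hx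
  exact hreal x hx

theorem norm_Gamma_mul_cpow_neg_le {s z : ℂ} (hs : 0 < s.re) (hz : 0 < z.re) :
    ‖Gamma s * z ^ (-s)‖ ≤ Real.Gamma s.re * z.re ^ (-s.re) := by
  rw [Gamma_mul_cpow_neg_eq_integral hs hz]
  refine (norm_integral_le_integral_norm _).trans_eq ?_
  rw [Real.rpow_neg hz.le, ← Real.inv_rpow hz.le, ← one_div, mul_comm,
    ← Real.integral_rpow_mul_exp_neg_mul_Ioi hs hz]
  refine setIntegral_congr_fun measurableSet_Ioi fun y hy => ?_
  rw [norm_mul, norm_cpow_eq_rpow_re_of_pos hy, norm_exp]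
  simp

/-- Rotating `z` by `β` without leaving the right half-plane changes `z^{-s}` by the factor
`e^{iβs}`, of norm `e^{-β Im s}`. -/
theorem norm_Gamma_mul_cpow_neg_le_of_rotation {s z : ℂ} {β : ℝ} (hs : 0 < s.re) (hz : 0 < z.re)
    (hβ : |β| < Real.pi / 2) (hzβ : 0 < (z * cexp (β * I)).re) :
    ‖Gamma s * z ^ (-s)‖
      ≤ Real.exp (-(β * s.im)) * (Real.Gamma s.re * (z * cexp (β * I)).re ^ (-s.re)) := by
  have hz0 : z ≠ 0 := fun h => by simp [h] at hz
  have hlog : Complex.log (z * cexp (β * I)) = Complex.log z + β * I := by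
    have h1 := abs_lt.1 (abs_arg_lt_pi_div_two_iff.2 (Or.inl hz))
    have h2 := abs_lt.1 hβ
    have harg : arg (cexp (β * I)) = β := by
      rw [arg_exp_mul_I, toIocMod_eq_self]
      constructor <;> linarith [Real.pi_pos]
    rw [Complex.log_mul hz0 (exp_ne_zero _), Complex.log_exp]
    · simp; linarith [Real.pi_pos]
    · simp; linarith [Real.pi_pos]
    · rw [harg]; constructor <;> linarith
  have hrot : z ^ (-s) = cexp (β * I * s) * (z * cexp (β * I)) ^ (-s) := by
    rw [cpow_def_of_ne_zero hz0, cpow_def_of_ne_zero (mul_ne_zero hz0 (exp_ne_zero _)), hlog,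
      ← Complex.exp_add]
    ring_nf
  rw [hrot, mul_left_comm, norm_mul, norm_exp]
  have : (β * I * s).re = -(β * s.im) := by simp
  rw [this]
  gcongr
  exact norm_Gamma_mul_cpow_neg_le hs hzβ

/-! ### Bounds for the integral of the `K`-Bessel function of order zero -/

theorem one_add_sq_div_two_le_cosh (v : ℝ) : 1 + v ^ 2 / 2 ≤ Real.cosh v := by
  have h1 : Real.cosh v = 1 + 2 * Real.sinh (v / 2) ^ 2 := by
    have h2 := Real.cosh_two_mul (v / 2)
    have h3 := Real.cosh_sq (v / 2)
    rw [mul_div_cancel₀ v two_ne_zero] at h2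
    linarith
  have h4 : (v / 2) ^ 2 ≤ Real.sinh (v / 2) ^ 2 := by
    rw [sq_le_sq, Real.abs_sinh]
    exact Real.self_le_sinh_iff.2 (abs_nonneg _)
  rw [h1]
  nlinarith

theorem lintegral_exp_neg_mul_cosh_le {x : ℝ} (hx : 0 < x) :
    ∫⁻ v : ℝ, ENNReal.ofReal (Real.exp (-(x * Real.cosh v)))
      ≤ ENNReal.ofReal (√(2 * Real.pi / x) * Real.exp (-x)) := by
  have hint : Integrable fun v : ℝ => Real.exp (-(x / 2) * v ^ 2) * Real.exp (-x) :=
    (integrable_exp_neg_mul_sq (half_pos hx)).mul_const _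
  have hval : ∫ v : ℝ, Real.exp (-(x / 2) * v ^ 2) * Real.exp (-x)
      = √(2 * Real.pi / x) * Real.exp (-x) := by
    rw [integral_mul_const, integral_gaussian]
    congr 2
    field_simp
  rw [← hval, ofReal_integral_eq_lintegral_ofReal hint
    (Filter.Eventually.of_forall fun v => by positivity)]
  refine lintegral_mono fun v => ENNReal.ofReal_le_ofReal ?_
  rw [← Real.exp_add, Real.exp_le_exp]
  have := mul_le_mul_of_nonneg_left (one_add_sq_div_two_le_cosh v) hx.le
  linarith

/-- On `|v| ≤ log (2 / x)` the integrand is at most `1`; beyond,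
`x cosh v ≥ exp (|v| - log (2 / x))` is at least `1 + |v| - log (2 / x)`. -/
theorem lintegral_exp_neg_mul_cosh_le_log {x : ℝ} (hx : 0 < x) (hx2 : x ≤ 2) :
    ∫⁻ v : ℝ, ENNReal.ofReal (Real.exp (-(x * Real.cosh v)))
      ≤ ENNReal.ofReal (2 * (Real.log 2 - Real.log x + Real.exp (-1))) := by
  set L := Real.log 2 - Real.log x with hL
  have hL0 : 0 ≤ L := sub_nonneg.2 (Real.log_le_log hx hx2)
  -- an integrable majorant for `v ≥ 0`, extended evenly
  set g : ℝ → ℝ := fun v => if v ≤ L then 1 else Real.exp (-1) * Real.exp (-(v - L)) with hg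
  have hg1 : IntegrableOn g (Ioc 0 L) := by
    refine (integrableOn_const (C := (1 : ℝ)) (by simp)).congr_fun (fun v hv => ?_)
      measurableSet_Ioc
    simp [hg, hv.2]
  have hg2' : IntegrableOn (fun v => Real.exp (-1) * Real.exp L * Real.exp (-v)) (Ioi L) :=
    (integrableOn_exp_neg_Ioi L).const_mul _
  have hgeq : EqOn (fun v => Real.exp (-1) * Real.exp L * Real.exp (-v)) g (Ioi L) := fun v hv => by
    simp only [hg, if_neg (not_le.2 (mem_Ioi.1 hv))]
    rw [mul_assoc, ← Real.exp_add]
    ring_nf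
  have hg2 : IntegrableOn g (Ioi L) := hg2'.congr_fun hgeq measurableSet_Ioi
  have hgint : IntegrableOn g (Ioi 0) := by
    rw [← Ioc_union_Ioi_eq_Ioi hL0]
    exact hg1.union hg2
  have hval : ∫ v in Ioi 0, g v = L + Real.exp (-1) := by
    rw [← Ioc_union_Ioi_eq_Ioi hL0, setIntegral_union (Ioc_disjoint_Ioi le_rfl) measurableSet_Ioi
      hg1 hg2, ← setIntegral_congr_fun measurableSet_Ioi hgeq, integral_const_mul,
      integral_exp_neg_Ioi, mul_assoc, ← Real.exp_add, add_neg_cancel, Real.exp_zero, mul_one]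
    congr 1
    rw [setIntegral_congr_fun measurableSet_Ioc (g := fun _ => (1 : ℝ)) fun v hv => by
      simp [hg, hv.2]]
    simp [hL0]
  have habs : Integrable fun v => g |v| := by
    -- a non-integrable function would have Bochner integral `0`
    refine .of_integral_ne_zero ?_
    rw [integral_comp_abs, hval]
    positivity
  have hg0 (v : ℝ) : 0 ≤ g v := by
    simp only [hg]
    split_ifs <;> positivity
  rw [← hval, ← integral_comp_abs, ofReal_integral_eq_lintegral_ofReal habs
    (Filter.Eventually.of_forall fun v => hg0 _)]
  refine lintegral_mono fun v => ENNReal.ofReal_le_ofReal ?_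
  simp only [hg]
  split_ifs with h
  · rw [Real.exp_le_one_iff]
    have := Real.cosh_pos v
    nlinarith
  · rw [← Real.exp_add, Real.exp_le_exp]
    have h1 : Real.exp (|v| - L) ≤ x * Real.cosh v := by
      rw [hL, Real.exp_sub, Real.exp_sub, Real.exp_log hx, Real.exp_log two_pos, ← Real.cosh_abs,
        Real.cosh_eq]
      have := mul_pos hx (Real.exp_pos (-|v|))
      rw [show x * ((Real.exp |v| + Real.exp (-|v|)) / 2)
        = (x * Real.exp |v| + x * Real.exp (-|v|)) / 2 by ring, div_div_eq_mul_div]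
      linarith
    have h2 := Real.add_one_le_exp (|v| - L)
    linarith

theorem integral_rpow_mul_sub_log {σ c : ℝ} (hσ : 0 < σ) (hc : 0 ≤ c) :
    IntegrableOn (fun x : ℝ => x ^ (σ - 1) * (c - Real.log x)) (Ioc 0 1) ∧
      ∫ x in Ioc (0 : ℝ) 1, x ^ (σ - 1) * (c - Real.log x) = σ⁻¹ * (σ⁻¹ + c) := by
  -- an antiderivative; it is continuous at `0` because `log x * x ^ σ` tends to `0`
  set G : ℝ → ℝ := fun x => σ⁻¹ * (c * x ^ σ - Real.log x * x ^ σ) + σ⁻¹ * (σ⁻¹ * x ^ σ) with hG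
  have hcont : ContinuousOn G (Icc 0 1) := by
    have h1 : Continuous fun x : ℝ => x ^ σ := Real.continuous_rpow_const hσ.le
    have h2 : ContinuousOn (fun x : ℝ => Real.log x * x ^ σ) (Icc 0 1) := by
      intro x hx
      rcases eq_or_lt_of_le hx.1 with rfl | hx0
      · refine ContinuousWithinAt.mono (t := Ici 0) ?_ Icc_subset_Ici_self
        rw [← continuousWithinAt_Ioi_iff_Ici, ContinuousWithinAt]
        simpa using tendsto_log_mul_rpow_nhdsGT_zero hσ
      · exact ((Real.continuousAt_log hx0.ne').mul h1.continuousAt).continuousWithinAt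
    exact (((h1.continuousOn.const_mul _).sub h2).const_mul _).add
      ((h1.continuousOn.const_mul _).const_mul _)
  have hderiv : ∀ x ∈ Ioo (0 : ℝ) 1, HasDerivAt G (x ^ (σ - 1) * (c - Real.log x)) x := by
    intro x hx
    have h1 := Real.hasDerivAt_rpow_const (x := x) (p := σ) (Or.inl hx.1.ne')
    have h2 := (Real.hasDerivAt_log hx.1.ne').mul h1
    refine ((((h1.const_mul c).sub h2).const_mul σ⁻¹).add
      ((h1.const_mul σ⁻¹).const_mul σ⁻¹)).congr_deriv ?_
    rw [Real.rpow_sub_one hx.1.ne']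
    have := hx.1.ne'
    field_simp
    ring
  have hnn : ∀ x ∈ Ioo (0 : ℝ) 1, 0 ≤ x ^ (σ - 1) * (c - Real.log x) := fun x hx =>
    mul_nonneg (Real.rpow_nonneg hx.1.le _)
      (by linarith [Real.log_nonpos hx.1.le hx.2.le])
  have hint := intervalIntegral.integrableOn_deriv_of_nonneg hcont hderiv hnn
  refine ⟨hint, ?_⟩
  rw [← intervalIntegral.integral_of_le zero_le_one,
    intervalIntegral.integral_eq_sub_of_hasDerivAt_of_le zero_le_one hcont hderiv
      ((intervalIntegrable_iff_integrableOn_Ioc_of_le zero_le_one).2 hint)]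
  simp [hG, Real.zero_rpow hσ.ne']
  ring

theorem integral_Ioi_one_rpow_mul_exp {a τ : ℝ} (hτ : 0 < τ) :
    ∫ x in Ioi (1 : ℝ), x ^ (a - 1) * Real.exp (-(τ * x))
      = τ ^ (-a) * upperIncompleteGamma a τ := by
  have h := integral_comp_mul_left_Ioi (fun v : ℝ => v ^ (a - 1) * Real.exp (-v)) 1 hτ
  rw [mul_one, ← upperIncompleteGamma] at h
  have h2 : ∫ x in Ioi (1 : ℝ), (τ * x) ^ (a - 1) * Real.exp (-(τ * x))
      = τ ^ (a - 1) * ∫ x in Ioi (1 : ℝ), x ^ (a - 1) * Real.exp (-(τ * x)) := by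
    rw [← integral_const_mul]
    refine setIntegral_congr_fun measurableSet_Ioi fun x hx => ?_
    have hx : 1 < x := hx
    rw [Real.mul_rpow hτ.le (by linarith), mul_assoc]
  rw [h2, smul_eq_mul, Real.rpow_sub_one hτ.ne'] at h
  rw [Real.rpow_neg hτ.le]
  have := Real.rpow_pos_of_pos hτ a
  field_simp at h ⊢
  linarith

theorem integrableOn_Ioi_one_rpow_mul_exp {a τ : ℝ} (ha : a ≤ 1) (hτ : 0 < τ) :
    IntegrableOn (fun x : ℝ => x ^ (a - 1) * Real.exp (-(τ * x))) (Ioi 1) := by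
  have h := integrableOn_exp_mul_Ioi (neg_lt_zero.2 hτ) 1
  refine Integrable.mono' h ?_ ?_
  · refine ContinuousOn.aestronglyMeasurable (fun x hx => ?_) measurableSet_Ioi
    have hx : 1 < x := hx
    exact ((Real.continuousAt_rpow_const _ _ (Or.inl (by positivity))).mul
      (by fun_prop)).continuousWithinAt
  · refine (ae_restrict_iff' measurableSet_Ioi).2 (Filter.Eventually.of_forall fun x hx => ?_)
    have hx : 1 < x := hx
    rw [Real.norm_of_nonneg (by positivity), neg_mul]
    exact mul_le_of_le_one_left (Real.exp_pos _).le
      (Real.rpow_le_one_of_one_le_of_nonpos hx.le (by linarith))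

theorem integrable_cosh_add_rpow_neg {σ T : ℝ} (hσ : 0 < σ) (hT : |T| < 1) :
    Integrable fun v : ℝ => (Real.cosh v + T) ^ (-σ) := by
  -- comparison with a multiple of `cosh v`, using `cosh v ≥ 1`
  have hlow (v : ℝ) : (1 - |T|) * Real.cosh v ≤ Real.cosh v + T := by
    have := Real.one_le_cosh v
    have := neg_abs_le T
    nlinarith [abs_nonneg T]
  have hpos (v : ℝ) : 0 < (1 - |T|) * Real.cosh v := mul_pos (by linarith) (Real.cosh_pos v)
  refine ((integrable_cosh_rpow_neg hσ).const_mul ((1 - |T|) ^ (-σ))).mono' ?_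
    (Filter.Eventually.of_forall fun v => ?_)
  · exact ((Real.continuous_cosh.add continuous_const).rpow_const fun v =>
      Or.inl ((hpos v).trans_le (hlow v)).ne').aestronglyMeasurable
  · rw [Real.norm_of_nonneg (Real.rpow_nonneg ((hpos v).trans_le (hlow v)).le _),
      ← Real.mul_rpow (by linarith) (Real.cosh_pos v).le]
    exact Real.rpow_le_rpow_of_nonpos (hpos v) (hlow v) (by linarith)

theorem integral_rpow_mul_cosh_mul_exp {σ T c : ℝ} (hσ : 0 < σ) (h1 : 0 < c + T) (h2 : 0 < c - T) :
    IntegrableOn (fun x : ℝ => x ^ (σ - 1) * Real.cosh (T * x) * Real.exp (-(x * c))) (Ioi 0) ∧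
    ∫ x in Ioi (0 : ℝ), x ^ (σ - 1) * Real.cosh (T * x) * Real.exp (-(x * c))
      = Real.Gamma σ * (((c + T) ^ (-σ) + (c - T) ^ (-σ)) / 2) := by
  have hi {d : ℝ} (hd : 0 < d) :
      IntegrableOn (fun x : ℝ => x ^ (σ - 1) * Real.exp (-(d * x))) (Ioi 0) := by
    simpa using integrableOn_rpow_mul_exp_neg_mul_rpow (p := 1) (s := σ - 1) (b := d)
      (by linarith) one_pos hd
  have heq : (fun x : ℝ => x ^ (σ - 1) * Real.cosh (T * x) * Real.exp (-(x * c)))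
      = fun x => (x ^ (σ - 1) * Real.exp (-((c + T) * x))
          + x ^ (σ - 1) * Real.exp (-((c - T) * x))) / 2 := by
    funext x
    rw [Real.cosh_eq, show -((c + T) * x) = -(T * x) + -(x * c) by ring,
      show -((c - T) * x) = T * x + -(x * c) by ring, Real.exp_add, Real.exp_add]
    ring
  rw [heq]
  refine ⟨((hi h1).add (hi h2)).div_const 2, ?_⟩
  rw [integral_div, integral_add (hi h1) (hi h2), Real.integral_rpow_mul_exp_neg_mul_Ioi hσ h1,
    Real.integral_rpow_mul_exp_neg_mul_Ioi hσ h2, one_div, one_div, Real.inv_rpow h1.le,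
    Real.inv_rpow h2.le, ← Real.rpow_neg h1.le, ← Real.rpow_neg h2.le]
  ring

/-- After Tonelli, the left side is `∫₀^∞ x^{σ-1} cosh (T x) (∫_ℝ e^{-x cosh v} dv) dx`. The inner
integral (`2 K₀(x)`) is bounded by its logarithmic growth for `x ≤ 1` and by its exponential decay
for `x > 1`. -/
theorem Gamma_mul_integral_cosh_add_rpow_le {σ T : ℝ} (hσ₀ : 0 < σ) (hσ₁ : σ ≤ 1) (hT₀ : 0 ≤ T)
    (hT₁ : T < 1) :
    Real.Gamma σ * ∫ v : ℝ, ((Real.cosh v + T) ^ (-σ) + (Real.cosh v - T) ^ (-σ)) / 2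
      ≤ 2 * (Real.cosh T * σ⁻¹ * (σ⁻¹ + Real.log 2 + Real.exp (-1))
        + √(Real.pi / 2) * (1 - T) ^ (1 / 2 - σ) * upperIncompleteGamma (σ - 1 / 2) (1 - T)) := by
  set g : ℝ → ℝ → ℝ := fun v x =>
    x ^ (σ - 1) * Real.cosh (T * x) * Real.exp (-(x * Real.cosh v)) with hg
  have hplus (v : ℝ) : 0 < Real.cosh v + T := by linarith [Real.cosh_pos v]
  have hminus (v : ℝ) : 0 < Real.cosh v - T := by linarith [Real.one_le_cosh v]
  have hg0 (v : ℝ) {x : ℝ} (hx : 0 < x) : 0 ≤ g v x := by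
    have := Real.cosh_pos (T * x)
    simp only [hg]
    positivity
  have hA (v : ℝ) : ∫⁻ x in Ioi 0, ENNReal.ofReal (g v x) = ENNReal.ofReal
      (Real.Gamma σ * (((Real.cosh v + T) ^ (-σ) + (Real.cosh v - T) ^ (-σ)) / 2)) := by
    obtain ⟨hi, hv⟩ := integral_rpow_mul_cosh_mul_exp hσ₀ (hplus v) (hminus v)
    rw [← hv, ofReal_integral_eq_lintegral_ofReal hi]
    exact (ae_restrict_iff' measurableSet_Ioi).2 (Filter.Eventually.of_forall fun x hx => hg0 v hx)
  set B : ℝ := 2 * (Real.cosh T * σ⁻¹ * (σ⁻¹ + Real.log 2 + Real.exp (-1))) with hB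
  set D : ℝ := 2 * (√(Real.pi / 2) * (1 - T) ^ (1 / 2 - σ) *
    upperIncompleteGamma (σ - 1 / 2) (1 - T)) with hD
  have hlog2 : 0 < Real.log 2 := Real.log_pos one_lt_two
  have hsmall : ∫⁻ x in Ioc 0 1, ∫⁻ v, ENNReal.ofReal (g v x) ≤ ENNReal.ofReal B := by
    obtain ⟨hi, hval⟩ := integral_rpow_mul_sub_log hσ₀
      (add_pos hlog2 (Real.exp_pos (-1))).le
    have hBval : ∫ x in Ioc (0 : ℝ) 1, Real.cosh T * 2 *
        (x ^ (σ - 1) * (Real.log 2 + Real.exp (-1) - Real.log x)) = B := by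
      rw [integral_const_mul, hval, hB]
      ring
    have hcT := Real.cosh_pos T
    rw [← hBval, ofReal_integral_eq_lintegral_ofReal (hi.const_mul _)]
    · refine setLIntegral_mono' measurableSet_Ioc fun x hx => ?_
      have hc : 0 ≤ x ^ (σ - 1) * Real.cosh (T * x) :=
        mul_nonneg (Real.rpow_nonneg hx.1.le _) (Real.cosh_pos _).le
      simp only [hg, ENNReal.ofReal_mul hc]
      rw [lintegral_const_mul' _ _ ENNReal.ofReal_ne_top]
      refine (mul_le_mul_right
        (lintegral_exp_neg_mul_cosh_le_log hx.1 (by linarith [hx.2])) _).trans ?_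
      rw [← ENNReal.ofReal_mul hc]
      refine ENNReal.ofReal_le_ofReal ?_
      have h1 : Real.cosh (T * x) ≤ Real.cosh T := by
        rw [Real.cosh_le_cosh, abs_of_nonneg hT₀, abs_of_nonneg (mul_nonneg hT₀ hx.1.le)]
        exact mul_le_of_le_one_right hT₀ hx.2
      have h2 : 0 ≤ x ^ (σ - 1) * (Real.log 2 + Real.exp (-1) - Real.log x) :=
        mul_nonneg (Real.rpow_nonneg hx.1.le _)
          (by linarith [Real.log_nonpos hx.1.le hx.2, Real.exp_pos (-1)])
      have := mul_le_mul_of_nonneg_left h1 h2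
      linarith
    · refine (ae_restrict_iff' measurableSet_Ioc).2 (Filter.Eventually.of_forall fun x hx => ?_)
      refine mul_nonneg (by positivity) (mul_nonneg (Real.rpow_nonneg hx.1.le _) ?_)
      linarith [Real.log_nonpos hx.1.le hx.2, Real.exp_pos (-1)]
  have hτ : 0 < 1 - T := by linarith
  have hlarge : ∫⁻ x in Ioi 1, ∫⁻ v, ENNReal.ofReal (g v x) ≤ ENNReal.ofReal D := by
    have hi := integrableOn_Ioi_one_rpow_mul_exp (a := σ - 1 / 2) (by linarith) hτ
    have hDval : ∫ x in Ioi (1 : ℝ), √(2 * Real.pi) *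
        (x ^ (σ - 1 / 2 - 1) * Real.exp (-((1 - T) * x))) = D := by
      rw [integral_const_mul, integral_Ioi_one_rpow_mul_exp hτ, hD,
        show 2 * Real.pi = 2 ^ 2 * (Real.pi / 2) by ring, Real.sqrt_mul (by positivity),
        Real.sqrt_sq two_pos.le, neg_sub]
      ring
    rw [← hDval, ofReal_integral_eq_lintegral_ofReal (hi.const_mul _)]
    · refine setLIntegral_mono' measurableSet_Ioi fun x hx => ?_
      have hx0 : 0 < x := one_pos.trans hx
      have hc : 0 ≤ x ^ (σ - 1) * Real.cosh (T * x) :=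
        mul_nonneg (Real.rpow_nonneg hx0.le _) (Real.cosh_pos _).le
      simp only [hg, ENNReal.ofReal_mul hc]
      rw [lintegral_const_mul' _ _ ENNReal.ofReal_ne_top]
      refine (mul_le_mul_right (lintegral_exp_neg_mul_cosh_le hx0) _).trans ?_
      rw [← ENNReal.ofReal_mul hc]
      refine ENNReal.ofReal_le_ofReal ?_
      have h1 : Real.cosh (T * x) ≤ Real.exp (T * x) := by
        have := mul_nonneg hT₀ hx0.le
        rw [Real.cosh_eq]
        have : Real.exp (-(T * x)) ≤ Real.exp (T * x) := Real.exp_le_exp.2 (by linarith)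
        linarith
      have h2 : x ^ (σ - 1 / 2 - 1) = x ^ (σ - 1) / √x := by
        rw [show σ - 1 / 2 - 1 = (σ - 1) - 1 / 2 by ring, Real.rpow_sub hx0, Real.sqrt_eq_rpow]
      rw [Real.sqrt_div (by positivity), h2, show -((1 - T) * x) = T * x + -x by ring, Real.exp_add]
      calc _ ≤ x ^ (σ - 1) * Real.exp (T * x) * (√(2 * Real.pi) / √x * Real.exp (-x)) := by gcongr
        _ = _ := by ring
    · refine (ae_restrict_iff' measurableSet_Ioi).2 (Filter.Eventually.of_forall fun x hx => ?_)
      have hx0 : 0 < x := one_pos.trans hx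
      positivity
  have hmeas : Measurable (Function.uncurry fun v x => ENNReal.ofReal (g v x)) := by
    simp only [hg, Function.uncurry_def]
    fun_prop
  have hB0 : 0 ≤ B := by
    have := Real.cosh_pos T
    positivity
  have hD0 : 0 ≤ D := by
    have : 0 ≤ upperIncompleteGamma (σ - 1 / 2) (1 - T) :=
      setIntegral_nonneg measurableSet_Ioi fun v hv => by
        have : 0 < v := hτ.trans hv
        positivity
    positivity
  have htotal : ∫⁻ v, ENNReal.ofReal
      (Real.Gamma σ * (((Real.cosh v + T) ^ (-σ) + (Real.cosh v - T) ^ (-σ)) / 2))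
      ≤ ENNReal.ofReal (B + D) := by
    simp only [← hA]
    rw [lintegral_lintegral_swap hmeas.aemeasurable, ← Ioc_union_Ioi_eq_Ioi zero_le_one,
      lintegral_union measurableSet_Ioi (Ioc_disjoint_Ioi le_rfl), ENNReal.ofReal_add hB0 hD0]
    exact add_le_add hsmall hlarge
  rw [mul_add, ← hB, ← hD, ← integral_const_mul, integral_eq_lintegral_of_nonneg_ae]
  · exact ENNReal.toReal_le_of_le_ofReal (add_nonneg hB0 hD0) htotal
  · exact Filter.Eventually.of_forall fun v => mul_nonneg (Real.Gamma_pos_of_pos hσ₀).le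
      (div_nonneg (add_nonneg (Real.rpow_nonneg (hplus v).le _)
        (Real.rpow_nonneg (hminus v).le _)) two_pos.le)
  · refine (continuous_const.mul
      (Continuous.div_const (Continuous.add ?_ ?_) _)).aestronglyMeasurable
    · exact (Real.continuous_cosh.add continuous_const).rpow_const fun v => Or.inl (hplus v).ne'
    · exact (Real.continuous_cosh.sub continuous_const).rpow_const fun v => Or.inl (hminus v).ne'

/-! ### Norms of the gamma factor -/

theorem norm_Gamma_mul_sechTransform_le {s : ℂ} (hs : 0 < s.re) (r : ℝ) {β u : ℝ}
    (hβ : |β| < Real.pi / 2) (hT : |u * Real.tan β| < 1) :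
    ‖Gamma s * sechTransform s r (u * I)‖ ≤ Real.exp (-(β * s.im)) * (Real.cos β ^ (-s.re) *
      (Real.Gamma s.re * ∫ v : ℝ, (Real.cosh v + u * Real.tan β) ^ (-s.re))) := by
  have hcos : 0 < Real.cos β := Real.cos_pos_of_mem_Ioo (abs_lt.1 hβ)
  rw [sechTransform, ← integral_const_mul, ← integral_const_mul, ← integral_const_mul,
    ← integral_const_mul]
  have hint := integrable_cosh_add_rpow_neg hs hT
  refine norm_integral_le_of_norm_le (((hint.const_mul _).const_mul _).const_mul _)
    (Filter.Eventually.of_forall fun v => ?_)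
  have hc := Real.cosh_pos v
  have hcT : 0 < Real.cosh v + u * Real.tan β := by
    have := Real.one_le_cosh v
    have := (abs_lt.1 hT).1
    linarith
  set z : ℂ := 1 - u * I * ((Real.cosh v)⁻¹ : ℝ) with hz
  have hzre : 0 < z.re := by simp [hz]
  have hrot : (z * cexp (β * I)).re
      = Real.cos β * ((Real.cosh v)⁻¹ * (Real.cosh v + u * Real.tan β)) := by
    rw [exp_mul_I, ← ofReal_cos, ← ofReal_sin, Real.tan_eq_sin_div_cos, hz]
    simp only [add_re, mul_re, sub_re, add_im, mul_im, sub_im, ofReal_re, ofReal_im, I_re, I_im,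
      one_re, one_im]
    field_simp
    ring
  have hpos : 0 < (z * cexp (β * I)).re := by
    rw [hrot]
    positivity
  rw [mul_left_comm, norm_mul, norm_exp_mul_cosh_cpow]
  refine (mul_le_mul_of_nonneg_left (norm_Gamma_mul_cpow_neg_le_of_rotation hs hzre hβ hpos)
    (Real.rpow_nonneg hc.le _)).trans_eq ?_
  rw [hrot, Real.mul_rpow hcos.le (by positivity), Real.mul_rpow (by positivity) hcT.le,
    Real.inv_rpow hc.le]
  have := (Real.rpow_pos_of_pos hc (-s.re)).ne'
  field_simp

theorem norm_parityTransform_le {s : ℂ} (hs : 0 < s.re) (r : ℝ) (ε : ℕ) {β u : ℝ}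
    (hβ : |β| < Real.pi / 2) (hT : |u * Real.tan β| < 1) :
    ‖parityTransform s r ε (u * I)‖ ≤ Real.exp (-(β * s.im)) * (Real.cos β ^ (-s.re) *
      (Real.Gamma s.re * ∫ v : ℝ, ((Real.cosh v + u * Real.tan β) ^ (-s.re) +
        (Real.cosh v - u * Real.tan β) ^ (-s.re)) / 2)) := by
  have hT' : |-u * Real.tan β| < 1 := by rwa [neg_mul, abs_neg]
  have h1 := norm_Gamma_mul_sechTransform_le hs r hβ hT
  have h2 := norm_Gamma_mul_sechTransform_le hs r (u := -u) hβ (by rwa [neg_mul, abs_neg])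
  have hi1 := integrable_cosh_add_rpow_neg hs hT
  have hi2 := integrable_cosh_add_rpow_neg hs hT'
  simp only [neg_mul, ← sub_eq_add_neg, ofReal_neg] at h2 hi2
  have h3 : ‖parityTransform s r ε (u * I)‖ ≤
      (‖Gamma s * sechTransform s r (u * I)‖ + ‖Gamma s * sechTransform s r (-(u * I))‖) / 2 := by
    have : parityTransform s r ε (u * I) = (Gamma s * sechTransform s r (u * I) +
        (-1) ^ ε * (Gamma s * sechTransform s r (-(u * I)))) / 2 := by
      rw [parityTransform]
      ring
    rw [this, norm_div, Complex.norm_ofNat]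
    gcongr
    refine (norm_add_le _ _).trans_eq ?_
    rw [norm_mul ((-1) ^ ε)]
    simp
  rw [integral_div, integral_add hi1 hi2]
  linarith

/-- Rotating by `α` with the sign of `Im s` turns the bound for `parityTransform` into exponential
decay. -/
theorem norm_parityTransform_lt {s : ℂ} (hs₀ : 0 < s.re) (hs₁ : s.re ≤ 1) (r : ℝ) (ε : ℕ) {α u : ℝ}
    (hu : 0 ≤ u) (hα₀ : 0 ≤ α) (hα₁ : α < Real.pi / 2) (hT : u * Real.tan α < 1) :
    ‖parityTransform s r ε (u * I)‖ < Real.exp (-α * |s.im|) * (Real.cos α ^ (-s.re) *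
      (2 * (Real.cosh 1 * s.re⁻¹ * (s.re⁻¹ + Real.log 2 + Real.exp (-1))
        + √(Real.pi / 2) * (1 - u * Real.tan α) ^ (1 / 2 - s.re) *
          upperIncompleteGamma (s.re - 1 / 2) (1 - u * Real.tan α)))) := by
  have hcos : 0 < Real.cos α := Real.cos_pos_of_mem_Ioo ⟨by linarith, hα₁⟩
  have hT₀ : 0 ≤ u * Real.tan α :=
    mul_nonneg hu (Real.tan_nonneg_of_nonneg_of_le_pi_div_two hα₀ hα₁.le)
  have key : ‖parityTransform s r ε (u * I)‖ ≤ Real.exp (-α * |s.im|) * (Real.cos α ^ (-s.re) *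
      (Real.Gamma s.re * ∫ v : ℝ, ((Real.cosh v + u * Real.tan α) ^ (-s.re) +
        (Real.cosh v - u * Real.tan α) ^ (-s.re)) / 2)) := by
    rcases le_total 0 s.im with h | h
    · have := norm_parityTransform_le hs₀ r ε (β := α) (u := u) (by rwa [abs_of_nonneg hα₀])
        (by rwa [abs_of_nonneg hT₀])
      rwa [abs_of_nonneg h, neg_mul]
    · have := norm_parityTransform_le hs₀ r ε (β := -α) (u := u)
        (by rwa [abs_neg, abs_of_nonneg hα₀])
        (by rwa [Real.tan_neg, mul_neg, abs_neg, abs_of_nonneg hT₀])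
      simp only [Real.tan_neg, Real.cos_neg, mul_neg, sub_neg_eq_add, ← sub_eq_add_neg] at this
      simp only [fun v => add_comm ((Real.cosh v - u * Real.tan α) ^ (-s.re))
        ((Real.cosh v + u * Real.tan α) ^ (-s.re))] at this
      rwa [abs_of_nonpos h, neg_mul_neg, ← neg_neg (α * s.im), ← neg_mul]
  refine key.trans_lt ?_
  refine mul_lt_mul_of_pos_left (mul_lt_mul_of_pos_left ?_ (Real.rpow_pos_of_pos hcos _))
    (Real.exp_pos _)
  refine (Gamma_mul_integral_cosh_add_rpow_le hs₀ hs₁ hT₀ hT).trans_lt ?_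
  have h1 : Real.cosh (u * Real.tan α) < Real.cosh 1 := by
    rwa [Real.cosh_lt_cosh, abs_of_nonneg hT₀, abs_one]
  have := Real.log_pos one_lt_two
  gcongr

namespace MaassCuspForm

variable {N : ℕ} (f : MaassCuspForm N)

theorem norm_gammaFactor {θ : ℝ} (hN : 0 < N) (hθ₀ : 0 < θ) (hθ₁ : θ < Real.pi / 2) {s : ℂ}
    (hs : 0 < s.re) :
    ‖f.gammaFactor θ s‖ = ‖f.w ^ (-(1 / 2) : ℂ)‖ * (Real.cos θ / √N) ^ (1 / 2 - s.re) *
      Real.pi ^ (-(s.re + f.ε)) * (‖parityTransform s f.r f.ε (Real.tan θ * I)‖ /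
        (2 ^ (s.re + f.ε - 1) * Real.tan θ ^ f.ε)) := by
  have htan : 0 < Real.tan θ := Real.tan_pos_of_pos_of_lt_pi_div_two hθ₀ hθ₁
  have hcos : 0 < Real.cos θ := Real.cos_pos_of_mem_Ioo ⟨by linarith, hθ₁⟩
  have hNR : (0 : ℝ) < √N := Real.sqrt_pos.2 (by exact_mod_cast hN)
  have hsq : ((Real.tan θ : ℂ) * I) ^ 2 = -((Real.tan θ : ℝ) : ℂ) ^ 2 := by
    rw [mul_pow, I_sq]
    ring
  have hslit : 1 - ((Real.tan θ : ℂ) * I) ^ 2 ∈ slitPlane := by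
    rw [hsq, sub_neg_eq_add]
    refine Or.inl ?_
    rw [← ofReal_pow, add_re, one_re, ofReal_re]
    positivity
  have hne : (Real.tan θ : ℂ) * I ≠ 0 := mul_ne_zero (by exact_mod_cast htan.ne') I_ne_zero
  have hG := gauss2F1_sq hs f.r f.parity_le_one hne hslit
  rw [hsq] at hG
  have hpi (c : ℂ) : ‖Gammaℝ c‖ = Real.pi ^ (-c.re / 2) * ‖Gamma (c / 2)‖ := by
    rw [Gammaℝ_def, norm_mul, norm_cpow_eq_rpow_re_of_pos Real.pi_pos]
    simp
  have hI : ‖I ^ (-(f.ε : ℤ))‖ = 1 := by simp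
  have h2 : ‖(2 : ℂ) ^ (s + f.ε - 1)‖ = 2 ^ (s.re + f.ε - 1) := by
    have := norm_cpow_eq_rpow_re_of_pos two_pos (s + f.ε - 1)
    simpa using this
  rw [← hG]
  simp only [gammaFactor, norm_mul, norm_pow, hpi, hI, h2,
    norm_cpow_eq_rpow_re_of_pos (div_pos hcos hNR), norm_real, norm_I, Real.norm_of_nonneg htan.le]
  have hpow : Real.pi ^ (-(s.re + f.ε))
      = Real.pi ^ (-(s + f.ε + I * f.r).re / 2) * Real.pi ^ (-(s + f.ε - I * f.r).re / 2) := by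
    rw [← Real.rpow_add Real.pi_pos]
    congr 1
    simp
  rw [hpow]
  have h2pos : (0 : ℝ) < 2 ^ (s.re + f.ε - 1) := by positivity
  have hre : (1 / 2 - s).re = 1 / 2 - s.re := by simp
  rw [hre]
  field_simp

theorem norm_cFactor {θ : ℝ} (hN : 0 < N) (hθ₀ : 0 < θ) (hθ₁ : θ < Real.pi / 2) (σ : ℝ) :
    ‖f.cFactor θ σ‖ = 4 * ‖f.w ^ (-(1 / 2) : ℂ)‖ / (2 * Real.pi * Real.tan θ) ^ f.ε *
      √N ^ (σ - 1 / 2) := by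
  have htan : 0 < Real.tan θ := Real.tan_pos_of_pos_of_lt_pi_div_two hθ₀ hθ₁
  have hNR : (0 : ℝ) < N := by exact_mod_cast hN
  have h : ‖(N : ℂ) ^ (1 / 2 * ((σ : ℂ) - 1 / 2))‖ = √N ^ (σ - 1 / 2) := by
    have := norm_cpow_eq_rpow_re_of_pos hNR (1 / 2 * ((σ : ℂ) - 1 / 2))
    rw [ofReal_natCast] at this
    rw [this, Real.sqrt_eq_rpow, ← Real.rpow_mul hNR.le]
    simp
  rw [cFactor, norm_mul, h, norm_div, norm_mul, norm_pow, norm_mul, norm_real,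
    Real.norm_of_nonneg htan.le]
  simp [abs_of_pos Real.pi_pos]

end MaassCuspForm

theorem mainTheorem4 {N : ℕ} (hN : 0 < N) (f : MaassCuspForm N) (σ t θ δ : ℝ)
    (hσ₀ : 0 < σ) (hσ₁ : σ ≤ 1) (hθ : 0 < θ) (hθδ : θ < δ) (hδ : δ < Real.pi / 2) :
    ‖f.gammaFactor θ (σ + t * Complex.I)‖
      < f.decayConst σ θ δ * Real.exp (-(δ - θ) * |t|) := by
  set s : ℂ := σ + t * Complex.I with hs
  have hre : s.re = σ := by simp [hs]
  have him : s.im = t := by simp [hs]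
  have hθ₁ : θ < Real.pi / 2 := hθδ.trans hδ
  set α := δ - θ with hα
  have hα₀ : 0 < α := sub_pos.2 hθδ
  have hα₁ : α < Real.pi / 2 := by linarith
  have hcosθ : 0 < Real.cos θ := Real.cos_pos_of_mem_Ioo ⟨by linarith, hθ₁⟩
  have hcosα : 0 < Real.cos α := Real.cos_pos_of_mem_Ioo ⟨by linarith, hα₁⟩
  have hcosδ : 0 < Real.cos δ := Real.cos_pos_of_mem_Ioo ⟨by linarith, hδ⟩
  have htan : 0 < Real.tan θ := Real.tan_pos_of_pos_of_lt_pi_div_two hθ hθ₁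
  -- the addition formula for `cos δ = cos (α + θ)`
  have hτ : 1 - Real.tan θ * Real.tan α = Real.cos δ / (Real.cos α * Real.cos θ) := by
    rw [show δ = α + θ by ring, Real.cos_add, Real.tan_eq_sin_div_cos, Real.tan_eq_sin_div_cos]
    field_simp
  have hτ₀ : 0 < Real.cos δ / (Real.cos α * Real.cos θ) := by positivity
  have hlt := norm_parityTransform_lt (s := s) (by rwa [hre]) (by rwa [hre]) f.r f.ε htan.le
    hα₀.le hα₁ (by linarith)
  rw [hre, him, hτ] at hlt
  set τ := Real.cos δ / (Real.cos α * Real.cos θ) with hτdef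
  have hδτ : Real.cos δ = Real.cos α * Real.cos θ * τ := by
    rw [hτdef]
    field_simp
  have hw : 0 < ‖f.w ^ (-(1 / 2) : ℂ)‖ := by
    have h0 : f.w ≠ 0 := fun h => by
      have := f.norm_w
      simp [h] at this
    rw [norm_pos_iff]
    simp [cpow_eq_zero_iff, h0]
  have hNR : (0 : ℝ) < √N := Real.sqrt_pos.2 (by exact_mod_cast hN)
  rw [f.norm_gammaFactor hN hθ hθ₁ (by rwa [hre]), hre]
  set S := Real.cosh 1 * σ⁻¹ * (σ⁻¹ + Real.log 2 + Real.exp (-1)) with hS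
  set V := upperIncompleteGamma (σ - 1 / 2) τ with hV
  calc _ < ‖f.w ^ (-(1 / 2) : ℂ)‖ * (Real.cos θ / √N) ^ (1 / 2 - σ) *
      Real.pi ^ (-(σ + f.ε)) * (Real.exp (-α * |t|) * (Real.cos α ^ (-σ) *
      (2 * (S + √(Real.pi / 2) * τ ^ (1 / 2 - σ) * V))) /
        (2 ^ (σ + f.ε - 1) * Real.tan θ ^ f.ε)) := by gcongr
    _ = _ := by
      rw [MaassCuspForm.decayConst, f.norm_cFactor hN hθ hθ₁, ← hα, ← hτdef, ← hS, ← hV, hδτ,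
        Real.sqrt_div Real.pi_pos.le]
      have h2 : √2 * √2 = 2 := Real.mul_self_sqrt two_pos.le
      have hpi := Real.pi_pos
      have hexp : (1 / 2 - σ) = -(σ - 1 / 2) := by ring
      rw [hexp, Real.div_rpow hcosθ.le hNR.le, Real.rpow_neg hcosθ.le, Real.rpow_neg hNR.le,
        Real.rpow_neg hτ₀.le, Real.rpow_neg hpi.le, Real.rpow_neg hcosα.le,
        Real.rpow_add hpi, Real.rpow_natCast, Real.rpow_sub two_pos, Real.rpow_add two_pos,
        Real.rpow_natCast, Real.rpow_one, Real.mul_rpow (x := 2 * Real.pi) (by positivity)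
          (by positivity), Real.mul_rpow (x := Real.cos α * Real.cos θ) (by positivity) hτ₀.le,
        Real.mul_rpow hcosα.le hcosθ.le, Real.mul_rpow two_pos.le hpi.le,
        Real.mul_rpow two_pos.le hpi.le, mul_pow, mul_pow,
        Real.rpow_sub two_pos, Real.rpow_sub hpi, Real.rpow_sub hcosα,
        ← Real.sqrt_eq_rpow, ← Real.sqrt_eq_rpow, ← Real.sqrt_eq_rpow]
      field_simp
      linear_combination (-4 * √Real.pi * V) * h2
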